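/- Work with metaformulas over a language $\mathcal L$ (a set of nonlogical predicates with arities), built from variable metavariables $x,y,z,\dots$ and formula metavariables $\phi,\psi,\dots$ (countably many of each) using $\equiv$, the predicates of $\mathcal L$, $\neg$, $\to$ and $\forall$. A scheme consists of a finite set of hypotheses, a conclusion, and a set of disjoint variable (DV) conditions, which are unordered pairs of distinct metavariables occurring in it. A substitution sends variable metavariables to variable metavariables and formula metavariables to metaformulas, and moves only finitely many metavariables; it is legitimate on a scheme if, whenever $\{m,n\}$ is a DV condition, the images of $m$ and $n$ have no common metavariable. An instance of a scheme is the result of a legitimate substitution, where each DV condition $\{m,n\}$ yields the conditions $\{m',n'\}$ for all $m'$ occurring in the image of $m$ and all $n'$ occurring in the image of $n$, possibly followed by the addition of DV conditions. A proof of a scheme $\Phi$ from a set $S$ of schemes is a finite sequence of metaformulas, ending with the conclusion of $\Phi$, in which each line is a hypothesis of $\Phi$ or follows from earlier lines by an instance of a scheme of $S$, the DV conditions available in the proof being those of $\Phi$ together with all pairs of distinct metavariables of the proof at least one of which does not occur in $\Phi$. A scheme is independent from $S$ if it has no proof from $S$. An object-instance of a scheme is obtained by legitimately substituting individual variables $v_0,v_1,\dots$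 for variable metavariables and first-order formulas over $\mathcal L$ for formula metavariables; a scheme is object-provable from $S$ if each of its object-instances has an ordinary proof from the object-instances of the schemes in $S$. Let $\mathtt{TMM}$ be the system over $\mathcal L$ consisting of the following schemes. $$\begin{array}{ll} \mathtt{mp} & \phi \;\&\; \phi\to\psi \implies \psi\\ \mathtt{minimp} & \phi \to ((\psi\to\chi) \to (((\theta\to\psi) \to (\chi\to\tau)) \to (\psi\to\tau)))\\ \mathtt{peirce} & ((\phi\to\psi)\to\phi)\to\phi\\ \mathtt{contrap} & (\phi\to\neg\psi)\to(\psi\to\neg\phi)\\ \mathtt{notelim} & \neg\phi\to(\phi\to\psi)\\ \mathtt{gen} & \phi\implies\forall x\,\phi\\ \mathtt{ALLdistr} & \forall x(\phi\to\psi)\to(\forall x\,\phi\to\forall x\,\psi)\\ \mathtt{spec} & \forall x\,\phi\to\phi\\ \mathtt{modal5} & \neg\forall x\,\phi\to\forall x\neg\forall x\,\phi\\ \mathtt{vacGen} & \phi\to\forall x\,\phi,\ \mathrm{DV}(x,\phi)\\ \mathtt{ALLcomm} & \forall x\forall y\,\phi\to\forall y\forall x\,\phi\\ \mathtt{EQrefl}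 & x\equiv x\\ \mathtt{EQsymm} & x\equiv y\to y\equiv x\\ \mathtt{EQtrans} & x\equiv y\to(y\equiv z\to x\equiv z)\\ \mathtt{denot} & x\equiv x\to\neg\forall y\neg\, y\equiv x,\ \mathrm{DV}(x,y)\\ \mathtt{subst} & \forall x(x\equiv y\to(\phi\to\forall x(x\equiv y\to\phi))),\ \mathrm{DV}(x,y),\ \mathrm{DV}(y,\phi)\\ \mathtt{ALLeq} & \forall x\,x\equiv y\to(\forall x\,\phi\to\forall y\,\phi)\\ \mathtt{genEq} & \neg\forall x\,x\equiv y\to(\neg\forall x\,x\equiv z\to(y\equiv z\to\forall x\,y\equiv z)) \end{array}$$ together with, for each predicate $P$ of $\mathcal L$ and each of its argument places, the predicate scheme $x\equiv y\to(P(z_1,\dots,x,\dots,z_n)\to P(z_1,\dots,y,\dots,z_n))$. Let $\mathtt T$ consist of $\mathtt{mp}$, $\mathtt{minimp}$, $\mathtt{peirce}$, $\mathtt{contrap}$, $\mathtt{notelim}$, $\mathtt{EQrefl}$, $\mathtt{EQsymm}$, $\mathtt{EQtrans}$, $\mathtt{gen}$, $\mathtt{ALLdistr}$, $\mathtt{vacGen}$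 and $\mathtt{denot}$. Then, for every language $\mathcal L$: 1. $\mathtt{spec}$ is independent from $\mathtt{TMM}\setminus\{\mathtt{spec},\mathtt{ALLeq}\}$. 2. $\mathtt{ALLeq}$ is independent from $\mathtt{TMM}\setminus\{\mathtt{spec},\mathtt{ALLeq}\}$. 3. The scheme $\forall x\,x\equiv y\to x\equiv y$ (with $x,y$ two different variable metavariables and no DV conditions) is an instance of $\mathtt{spec}$ without formula metavariables, it is independent from $\mathtt{TMM}\setminus\{\mathtt{spec},\mathtt{ALLeq}\}$, and yet it is object-provable from $\mathtt T$. -/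

import Mathlib

namespace TMMLogic

universe u

/-- A language: a set of nonlogical predicates together with an arity function. -/
structure PredLanguage : Type (u + 1) where
  Pred : Type u
  arity : Pred → ℕ

/-- Metavariables: `vr i` is the variable metavariable `x_i` and `fm i` is the formula
metavariable `φ_i`. -/
inductive MetaVar : Type
  | vr (i : ℕ)
  | fm (i : ℕ)

/-- Metaformulas on `L`.  A variable metavariable `x_i` is denoted by its index `i`. -/
inductive MetaFormula (L : PredLanguage.{u}) : Type u
  | fm (i : ℕ) : MetaFormula L
  | eq (i j : ℕ) : MetaFormula L
  | pred (P : L.Pred) (args : Fin (L.arity P) → ℕ) : MetaFormula L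
  | neg (A : MetaFormula L) : MetaFormula L
  | imp (A B : MetaFormula L) : MetaFormula L
  | all (i : ℕ) (A : MetaFormula L) : MetaFormula L

variable {L : PredLanguage.{u}}

/-- The set of metavariables occurring in a metaformula (including the quantified ones). -/
def MetaFormula.OC : MetaFormula L → Set MetaVar
  | .fm i => {MetaVar.fm i}
  | .eq i j => {MetaVar.vr i, MetaVar.vr j}
  | .pred _ args => Set.range (fun k => MetaVar.vr (args k))
  | .neg A => A.OC
  | .imp A B => A.OC ∪ B.OC
  | .all i A => insert (MetaVar.vr i) A.OC

/-- The metavariables occurring in the metaformulas of the set `H` or in `c`. -/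
def occurring (H : Set (MetaFormula L)) (c : MetaFormula L) : Set MetaVar :=
  {m | m ∈ c.OC ∨ ∃ A ∈ H, m ∈ A.OC}

/-- A scheme: a finite set of hypotheses, a conclusion, and a set of disjoint variable (DV)
conditions, which are unordered pairs of two different metavariables occurring in the
hypotheses or in the conclusion. -/
structure Scheme (L : PredLanguage.{u}) : Type u where
  hyps : Set (MetaFormula L)
  hyps_finite : hyps.Finite
  concl : MetaFormula L
  dv : Set (Sym2 MetaVar)
  dv_sub : ∀ p ∈ dv, ¬ p.IsDiag ∧ ∀ m ∈ p, m ∈ occurring hyps concl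

/-- The set of metavariables occurring in a scheme. -/
def Scheme.OC (Φ : Scheme L) : Set MetaVar := occurring Φ.hyps Φ.concl

/-- The scheme with the given hypotheses and conclusion, and with those DV conditions in `D`
that are pairs of different metavariables occurring in it. -/
def Scheme.ofDV (H : Set (MetaFormula L)) (hH : H.Finite) (c : MetaFormula L)
    (D : Set (Sym2 MetaVar)) : Scheme L where
  hyps := H
  hyps_finite := hH
  concl := c
  dv := {p | p ∈ D ∧ ¬ p.IsDiag ∧ ∀ m ∈ p, m ∈ occurring H c}
  dv_sub := fun _ hp => hp.2

/-- A type-preserving substitution, which moves only finitely many metavariables. -/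
structure Substitution (L : PredLanguage.{u}) : Type u where
  vr : ℕ → ℕ
  fm : ℕ → MetaFormula L
  vr_finite : {i | vr i ≠ i}.Finite
  fm_finite : {i | fm i ≠ MetaFormula.fm i}.Finite

/-- The action of a substitution on a metaformula. -/
def Substitution.act (σ : Substitution L) : MetaFormula L → MetaFormula L
  | .fm i => σ.fm i
  | .eq i j => .eq (σ.vr i) (σ.vr j)
  | .pred P args => .pred P (fun k => σ.vr (args k))
  | .neg A => .neg (σ.act A)
  | .imp A B => .imp (σ.act A) (σ.act B)
  | .all i A => .all (σ.vr i) (σ.act A)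

/-- The set of metavariables occurring in the image of a metavariable. -/
def Substitution.OC (σ : Substitution L) : MetaVar → Set MetaVar
  | .vr i => {MetaVar.vr (σ.vr i)}
  | .fm i => (σ.fm i).OC

/-- The action of a substitution on a set of DV conditions. -/
def Substitution.actDV (σ : Substitution L) (D : Set (Sym2 MetaVar)) : Set (Sym2 MetaVar) :=
  {p | ∃ m n m' n', p = s(m, n) ∧ m ≠ n ∧ s(m', n') ∈ D ∧ m ∈ σ.OC m' ∧ n ∈ σ.OC n'}

/-- A substitution is legitimate on a scheme if it does not violate its DV conditions. -/
def Substitution.Legitimate (σ : Substitution L) (Φ : Scheme L) : Prop :=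
  ∀ m n, s(m, n) ∈ Φ.dv → Disjoint (σ.OC m) (σ.OC n)

/-- `Ψ` is an instance of `Φ`: the result of a legitimate substitution, possibly followed by the
addition of DV conditions. -/
def IsInstance (Ψ Φ : Scheme L) : Prop :=
  ∃ σ : Substitution L, σ.Legitimate Φ ∧ Ψ.hyps = σ.act '' Φ.hyps ∧
    Ψ.concl = σ.act Φ.concl ∧ σ.actDV Φ.dv ⊆ Ψ.dv

/-- The set of metavariables occurring in a sequence of metaformulas. -/
def linesOC (P : List (MetaFormula L)) : Set MetaVar := {m | ∃ A ∈ P, m ∈ A.OC}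

/-- The DV conditions of a proof with lines `P` of the scheme `Φ`: those of `Φ`, and all those
between a dummy metavariable and another metavariable of the proof. -/
def proofDV (Φ : Scheme L) (P : List (MetaFormula L)) : Set (Sym2 MetaVar) :=
  Φ.dv ∪ {p | ∃ m n, p = s(m, n) ∧ m ≠ n ∧ m ∈ linesOC P \ Φ.OC ∧ n ∈ linesOC P}

/-- `P` is (the sequence of lines of) a proof of the scheme `Φ` from the set of schemes `S`. -/
def IsProof (S : Set (Scheme L)) (Φ : Scheme L) (P : List (MetaFormula L)) : Prop :=
  (∀ (k : ℕ) (A : MetaFormula L), P[k]? = some A → A ∈ Φ.hyps ∨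
    ∃ (I : Set (MetaFormula L)) (hI : I.Finite), (∀ B ∈ I, ∃ j < k, P[j]? = some B) ∧
      ∃ R ∈ S, IsInstance (Scheme.ofDV I hI A (proofDV Φ P)) R) ∧
  P.getLast? = some Φ.concl

/-- The scheme `Φ` is provable from the set of schemes `S`. -/
def Provable (S : Set (Scheme L)) (Φ : Scheme L) : Prop := ∃ P, IsProof S Φ P

/-- A scheme is independent from a set of schemes if it is not provable from it. -/
def Independent (S : Set (Scheme L)) (Φ : Scheme L) : Prop := ¬ Provable S Φ

/-- (Object-level) formulas of first-order logic on `L`, with individual variables `v_i`, denoted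
by their indices. -/
inductive Formula (L : PredLanguage.{u}) : Type u
  | eq (i j : ℕ) : Formula L
  | pred (P : L.Pred) (args : Fin (L.arity P) → ℕ) : Formula L
  | neg (A : Formula L) : Formula L
  | imp (A B : Formula L) : Formula L
  | all (i : ℕ) (A : Formula L) : Formula L

/-- The set of (indices of) variables occurring in a formula (including the quantified ones). -/
def Formula.OC : Formula L → Set ℕ
  | .eq i j => {i, j}
  | .pred _ args => Set.range args
  | .neg A => A.OC
  | .imp A B => A.OC ∪ B.OC
  | .all i A => insert i A.OC

/-- A formula with hypotheses. -/
structure FormulaWithHyps (L : PredLanguage.{u}) : Type u where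
  hyps : Set (Formula L)
  concl : Formula L

/-- An object-substitution. -/
structure ObjSubstitution (L : PredLanguage.{u}) : Type u where
  vr : ℕ → ℕ
  fm : ℕ → Formula L

/-- The action of an object-substitution on a metaformula. -/
def ObjSubstitution.act (τ : ObjSubstitution L) : MetaFormula L → Formula L
  | .fm i => τ.fm i
  | .eq i j => .eq (τ.vr i) (τ.vr j)
  | .pred P args => .pred P (fun k => τ.vr (args k))
  | .neg A => .neg (τ.act A)
  | .imp A B => .imp (τ.act A) (τ.act B)
  | .all i A => .all (τ.vr i) (τ.act A)

/-- The set of variables occurring in the image of a metavariable. -/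
def ObjSubstitution.OC (τ : ObjSubstitution L) : MetaVar → Set ℕ
  | .vr i => {τ.vr i}
  | .fm i => (τ.fm i).OC

/-- An object-substitution is legitimate on a scheme if it does not violate its DV conditions. -/
def ObjSubstitution.Legitimate (τ : ObjSubstitution L) (Φ : Scheme L) : Prop :=
  ∀ m n, s(m, n) ∈ Φ.dv → Disjoint (τ.OC m) (τ.OC n)

/-- `F` is an object-instance of the scheme `Φ`. -/
def IsObjInstance (F : FormulaWithHyps L) (Φ : Scheme L) : Prop :=
  ∃ τ : ObjSubstitution L, τ.Legitimate Φ ∧ F.hyps = τ.act '' Φ.hyps ∧ F.concl = τ.act Φ.concl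

/-- `P` is an object-level proof of `F` from the set `S` of formulas with hypotheses. -/
def IsObjProof (S : Set (FormulaWithHyps L)) (F : FormulaWithHyps L)
    (P : List (Formula L)) : Prop :=
  (∀ (k : ℕ) (A : Formula L), P[k]? = some A → A ∈ F.hyps ∨
    ∃ I : Set (Formula L), (∀ B ∈ I, ∃ j < k, P[j]? = some B) ∧
      (⟨I, A⟩ : FormulaWithHyps L) ∈ S) ∧
  P.getLast? = some F.concl

/-- `Φ` is object-provable from `S`: every object-instance of `Φ` has an object-level proof from
the object-instances of the schemes in `S`. -/
def ObjectProvable (S : Set (Scheme L)) (Φ : Scheme L) : Prop :=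
  ∀ F, IsObjInstance F Φ → ∃ P, IsObjProof {G | ∃ R ∈ S, IsObjInstance G R} F P

section Schemes

open MetaFormula

/-- The hypothesis-free scheme with conclusion `c` and DV conditions `D`. -/
def simpleScheme (c : MetaFormula L) (D : Set (Sym2 MetaVar)) : Scheme L :=
  Scheme.ofDV ∅ Set.finite_empty c D

variable (L)

/-- `φ & φ → ψ ⟹ ψ` -/
def schMp : Scheme L :=
  Scheme.ofDV {fm 0, imp (fm 0) (fm 1)} (Set.toFinite _) (fm 1) ∅

/-- `φ → ((ψ → χ) → (((θ → ψ) → (χ → τ)) → (ψ → τ)))` -/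
def schMinimp : Scheme L :=
  simpleScheme (imp (fm 0) (imp (imp (fm 1) (fm 2))
    (imp (imp (imp (fm 3) (fm 1)) (imp (fm 2) (fm 4))) (imp (fm 1) (fm 4))))) ∅

/-- `((φ → ψ) → φ) → φ` -/
def schPeirce : Scheme L :=
  simpleScheme (imp (imp (imp (fm 0) (fm 1)) (fm 0)) (fm 0)) ∅

/-- `(φ → ¬ψ) → (ψ → ¬φ)` -/
def schContrap : Scheme L :=
  simpleScheme (imp (imp (fm 0) (neg (fm 1))) (imp (fm 1) (neg (fm 0)))) ∅

/-- `¬φ → (φ → ψ)` -/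
def schNotelim : Scheme L :=
  simpleScheme (imp (neg (fm 0)) (imp (fm 0) (fm 1))) ∅

/-- `φ ⟹ ∀x φ` -/
def schGen : Scheme L :=
  Scheme.ofDV {fm 0} (Set.finite_singleton _) (all 0 (fm 0)) ∅

/-- `∀x (φ → ψ) → (∀x φ → ∀x ψ)` -/
def schALLdistr : Scheme L :=
  simpleScheme (imp (all 0 (imp (fm 0) (fm 1))) (imp (all 0 (fm 0)) (all 0 (fm 1)))) ∅

/-- `∀x φ → φ` -/
def schSpec : Scheme L :=
  simpleScheme (imp (all 0 (fm 0)) (fm 0)) ∅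

/-- `¬∀x φ → ∀x ¬∀x φ` -/
def schModal5 : Scheme L :=
  simpleScheme (imp (neg (all 0 (fm 0))) (all 0 (neg (all 0 (fm 0))))) ∅

/-- `φ → ∀x φ , DV(x, φ)` -/
def schVacGen : Scheme L :=
  simpleScheme (imp (fm 0) (all 0 (fm 0))) {s(MetaVar.vr 0, MetaVar.fm 0)}

/-- `∀x ∀y φ → ∀y ∀x φ` -/
def schALLcomm : Scheme L :=
  simpleScheme (imp (all 0 (all 1 (fm 0))) (all 1 (all 0 (fm 0)))) ∅

/-- `x ≡ x` -/
def schEQrefl : Scheme L := simpleScheme (eq 0 0) ∅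

/-- `x ≡ y → y ≡ x` -/
def schEQsymm : Scheme L := simpleScheme (imp (eq 0 1) (eq 1 0)) ∅

/-- `x ≡ y → (y ≡ z → x ≡ z)` -/
def schEQtrans : Scheme L := simpleScheme (imp (eq 0 1) (imp (eq 1 2) (eq 0 2))) ∅

/-- `x ≡ x → ¬∀y ¬ y ≡ x , DV(x, y)` -/
def schDenot : Scheme L :=
  simpleScheme (imp (eq 0 0) (neg (all 1 (neg (eq 1 0))))) {s(MetaVar.vr 0, MetaVar.vr 1)}

/-- `∀x (x ≡ y → (φ → ∀x (x ≡ y → φ))) , DV(x, y) , DV(y, φ)` -/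
def schSubst : Scheme L :=
  simpleScheme (all 0 (imp (eq 0 1) (imp (fm 0) (all 0 (imp (eq 0 1) (fm 0))))))
    {s(MetaVar.vr 0, MetaVar.vr 1), s(MetaVar.vr 1, MetaVar.fm 0)}

/-- `∀x x ≡ y → (∀x φ → ∀y φ)` -/
def schALLeq : Scheme L :=
  simpleScheme (imp (all 0 (eq 0 1)) (imp (all 0 (fm 0)) (all 1 (fm 0)))) ∅

/-- `¬∀x x ≡ y → (¬∀x x ≡ z → (y ≡ z → ∀x y ≡ z))` -/
def schGenEq : Scheme L :=
  simpleScheme (imp (neg (all 0 (eq 0 1))) (imp (neg (all 0 (eq 0 2)))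
    (imp (eq 1 2) (all 0 (eq 1 2))))) ∅

/-- The predicate scheme `x ≡ y → (P(z₁, …, x, …, zₙ) → P(z₁, …, y, …, zₙ))`, with `x`, `y` at
the place `j` and with `x`, `y` and the `z`s pairwise different variable metavariables. -/
def schPred (P : L.Pred) (j : Fin (L.arity P)) : Scheme L :=
  simpleScheme (imp (eq 0 1)
    (imp (pred P (Function.update (fun k => (k : ℕ) + 2) j 0))
      (pred P (Function.update (fun k => (k : ℕ) + 2) j 1)))) ∅

def propcalc : Set (Scheme L) :=
  {schMp L, schMinimp L, schPeirce L, schContrap L, schNotelim L}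

def EQ : Set (Scheme L) := {schEQrefl L, schEQsymm L, schEQtrans L}

/-- The system `T`. -/
def sysT : Set (Scheme L) :=
  propcalc L ∪ EQ L ∪ {schGen L, schALLdistr L, schVacGen L, schDenot L}

/-- The full system `TMM` on the language `L`, including its predicate schemes. -/
def sysTMM : Set (Scheme L) :=
  propcalc L ∪ {schGen L, schALLdistr L, schSpec L, schModal5 L} ∪ {schVacGen L, schALLcomm L} ∪
    EQ L ∪ {schDenot L, schSubst L, schALLeq L, schGenEq L} ∪
    {R | ∃ (P : L.Pred) (j : Fin (L.arity P)), R = schPred L P j}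

/-- `∀x x ≡ y → x ≡ y`, with no DV conditions. -/
def schSpecEq : Scheme L := simpleScheme (imp (all 0 (eq 0 1)) (eq 0 1)) ∅

end Schemes

end TMMLogic

namespace TMMLogic

universe u

variable {L : PredLanguage.{u}}

/-! ### Semantics for schematic provability

A `Frame p` interprets every quantifier `∀ x` as the modal box of a relation on worlds.  The pair
`p` of metavariables is the one that is not subject to a disjoint variable condition. -/

/-! Independence is proved by countermodels in which quantifiers are modal boxes, one accessibility
relation per variable metavariable. If Φ has no DV conditions, then in a proof of Φ the only pairs
of distinct metavariables without a DV condition are those with both members occurring in Φ. So it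
suffices to choose one such pair `p` and a model where every scheme other than `spec` and `ALLeq` is
valid as long as its DV conditions exclude equality and the pair `p` (`Frame.valid_of_provable`).
Accessibility need not be reflexive, which is where `spec` can fail. For `spec` and `ALLeq` the pair
is x₀, φ₀: ∀x₀ looks only at a world where φ₀ holds, while ∀x₁ stays at the current world. For ∀x
x≡y → x≡y the pair is x₀, x₁: quantifying over either one makes the two equal. Object variables, in
contrast, are either equal or different. If x and y are the same, reflexivity suffices; otherwise
`vacGen` applies, and `denot` with a fresh variable w carries ∀x x≡y to ∀w w≡y and back to x≡y. -/

/-- Two metavariables are separated when they are different and do not form the pair `p`. -/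
def Separated (p : Sym2 MetaVar) (m n : MetaVar) : Prop := m ≠ n ∧ s(m, n) ≠ p

/-- A modal interpretation of metaformulas.  The relation `inv i` relates worlds that cannot be told
apart by the metavariables separated from the variable metavariable `i`. -/
structure Frame (p : Sym2 MetaVar) where
  World : Type
  Dom : Type
  val : World → ℕ → Dom
  fm : World → ℕ → Prop
  rel : ℕ → World → World → Prop
  inv : ℕ → World → World → Prop
  -- `inv` is kept apart from `rel` because accessibility need not be symmetric, and invariance of
  -- quantified formulas needs the transfer in both directions.
  inv_of_rel : ∀ {i w v}, rel i w v → inv i w v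
  inv_symm : ∀ {i w v}, inv i w v → inv i v w
  inv_val : ∀ {i j w v}, inv i w v → Separated p (.vr i) (.vr j) → val w j = val v j
  inv_fm : ∀ {i j w v}, inv i w v → Separated p (.vr i) (.fm j) → (fm w j ↔ fm v j)
  inv_forth : ∀ {i j w v u}, inv i w v → Separated p (.vr i) (.vr j) → rel j w u →
    ∃ t, rel j v t ∧ inv i u t
  -- From here on, the conditions correspond to `modal5`, `ALLcomm`, `denot`, `subst` and `genEq`.
  euclidean : ∀ {i w u v}, rel i w u → rel i w v → rel i u v
  comm : ∀ {i j w u v}, rel j w u → rel i u v → ∃ t, rel i w t ∧ rel j t v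
  denot : ∀ {i j} w, Separated p (.vr i) (.vr j) → ∃ u, rel j w u ∧ val u j = val u i
  subst : ∀ {i j w u v}, Separated p (.vr i) (.vr j) → rel i w u → rel i u v →
    val u i = val u j → val v i = val v j → u = v
  genEq : ∀ {i j k w u u' v}, rel i w u → val u i ≠ val u j → rel i w u' → val u' i ≠ val u' k →
    val w j = val w k → rel i w v → val v j = val v k

namespace Frame

variable {p : Sym2 MetaVar} (F : Frame p)

/-- Truth of a metaformula at a world, all atomic formulas `P(…)` being true. -/
def Sat : F.World → MetaFormula L → Prop
  | w, .fm i => F.fm w i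
  | w, .eq i j => F.val w i = F.val w j
  | _, .pred _ _ => True
  | w, .neg A => ¬ Sat w A
  | w, .imp A B => Sat w A → Sat w B
  | w, .all i A => ∀ v, F.rel i w v → Sat v A

/-- `inv i` is a bisimulation for the language of metavariables separated from xᵢ; this is what
validates `vacGen`. -/
theorem sat_iff_of_inv {i : ℕ} (A : MetaFormula L) (hA : ∀ m ∈ A.OC, Separated p (.vr i) m)
    {w v : F.World} (h : F.inv i w v) : F.Sat w A ↔ F.Sat v A := by
  induction A generalizing w v with
  | fm j => exact F.inv_fm h (hA _ rfl)
  | eq j k =>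
    simp only [Sat]
    rw [F.inv_val h (hA (.vr j) (Or.inl rfl)), F.inv_val h (hA (.vr k) (Or.inr rfl))]
  | pred => exact Iff.rfl
  | neg A ih => exact not_congr (ih hA h)
  | imp A B ihA ihB =>
    exact imp_congr (ihA (fun m hm => hA m (Or.inl hm)) h) (ihB (fun m hm => hA m (Or.inr hm)) h)
  | all j A ih =>
    have hj := hA (.vr j) (Or.inl rfl)
    have ih' : ∀ {w v : F.World}, F.inv i w v → (F.Sat w A ↔ F.Sat v A) :=
      fun h => ih (fun m hm => hA m (Or.inr hm)) h
    constructor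
    · intro hw t ht
      obtain ⟨t', ht', hi⟩ := F.inv_forth (F.inv_symm h) hj ht
      exact (ih' hi).2 (hw t' ht')
    · intro hv t ht
      obtain ⟨t', ht', hi⟩ := F.inv_forth h hj ht
      exact (ih' hi).2 (hv t' ht')

/-- A metaformula is valid if it is true at all worlds. -/
def Valid (A : MetaFormula L) : Prop := ∀ w, F.Sat w A

theorem valid_of_instance {R : Scheme L}
    (hR : R ∈ sysTMM L \ {schSpec L, schALLeq L}) (σ : Substitution L)
    (hσ : ∀ m n, s(m, n) ∈ R.dv → ∀ m' ∈ σ.OC m, ∀ n' ∈ σ.OC n, Separated p m' n')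
    (hyp : ∀ A ∈ R.hyps, F.Valid (σ.act A)) : F.Valid (σ.act R.concl) := by
  obtain ⟨hR, hn⟩ := hR
  simp only [sysTMM, propcalc, EQ, Set.mem_union, Set.mem_insert_iff, Set.mem_singleton_iff,
    Set.mem_ofPred_eq] at hR hn
  rcases hR with (((((rfl | rfl | rfl | rfl | rfl) | (rfl | rfl | rfl | rfl)) | (rfl | rfl)) |
    (rfl | rfl | rfl)) | (rfl | rfl | rfl | rfl)) | ⟨P, j, rfl⟩
  -- `mp`
  · intro w
    exact hyp (.imp (.fm 0) (.fm 1)) (Or.inr rfl) w (hyp (.fm 0) (Or.inl rfl) w)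
  -- propositional schemes
  · intro w
    simp only [schMinimp, simpleScheme, Scheme.ofDV, Substitution.act, Sat]
    tauto
  · intro w
    simp only [schPeirce, simpleScheme, Scheme.ofDV, Substitution.act, Sat]
    tauto
  · intro w
    simp only [schContrap, simpleScheme, Scheme.ofDV, Substitution.act, Sat]
    tauto
  · intro w
    simp only [schNotelim, simpleScheme, Scheme.ofDV, Substitution.act, Sat]
    tauto
  -- `gen`
  · intro w v _
    exact hyp (.fm 0) rfl v
  -- `ALLdistr`
  · intro w h h' v hv
    exact h v hv (h' v hv)
  · exact absurd (Or.inl rfl) hn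
  -- `modal5`
  · intro w h v hv h'
    exact h fun u hu => h' u (F.euclidean hv hu)
  -- `vacGen`
  · intro w h v hv
    have hs : ∀ m ∈ (σ.fm 0).OC, Separated p (.vr (σ.vr 0)) m := fun m hm =>
      hσ (.vr 0) (.fm 0)
        ⟨rfl, by simp, by simp [occurring, MetaFormula.OC]⟩ _ rfl m hm
    exact (F.sat_iff_of_inv _ hs (F.inv_of_rel hv)).1 h
  -- `ALLcomm`
  · intro w h u hu v hv
    obtain ⟨t, ht, htv⟩ := F.comm hu hv
    exact h t ht v htv
  -- equality
  · intro w
    exact rfl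
  · intro w h
    exact Eq.symm h
  · intro w h h'
    exact Eq.trans h h'
  -- `denot`
  · intro w _ h
    have hs : Separated p (.vr (σ.vr 0)) (.vr (σ.vr 1)) :=
      hσ (.vr 0) (.vr 1) ⟨rfl, by simp, by simp [occurring, MetaFormula.OC]⟩ _ rfl _ rfl
    obtain ⟨u, hu, he⟩ := F.denot w hs
    exact h u hu he
  -- `subst`
  · intro w u hu he h v hv he'
    have hs : Separated p (.vr (σ.vr 0)) (.vr (σ.vr 1)) :=
      hσ (.vr 0) (.vr 1) ⟨Or.inl rfl, by simp, by simp [occurring, MetaFormula.OC]⟩ _ rfl _ rfl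
    exact F.subst hs hu hv he he' ▸ h
  · exact absurd (Or.inr rfl) hn
  -- `genEq`
  · intro w h h' he v hv
    simp only [Substitution.act, Sat, not_forall] at h h'
    obtain ⟨u, hu, hne⟩ := h
    obtain ⟨u', hu', hne'⟩ := h'
    exact F.genEq hu hne hu' hne' he hv
  -- predicate schemes
  · intro w _ _
    trivial

/-- The DV conditions of a proof come from Φ or involve a dummy not occurring in Φ. Neither kind can
be `p`, so every instance used respects separation and soundness follows by induction on the lines.
-/
theorem valid_of_provable {Φ : Scheme L} (hΦ : Φ.hyps = ∅) (hdv : p ∉ Φ.dv)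
    (hoc : ∀ m ∈ p, m ∈ Φ.OC) (h : Provable (sysTMM L \ {schSpec L, schALLeq L}) Φ) :
    F.Valid Φ.concl := by
  obtain ⟨P, hP, hlast⟩ := h
  have key : ∀ (k : ℕ) (A : MetaFormula L), P[k]? = some A → F.Valid A := by
    intro k
    induction k using Nat.strong_induction_on with
    | _ k ih =>
      intro A hA
      rcases hP k A hA with h | ⟨I, hI, hlines, R, hR, σ, hleg, hhyps, hconcl, hact⟩
      · simp [hΦ] at h
      · change A = σ.act R.concl at hconcl
        change I = σ.act '' R.hyps at hhyps
        subst hhyps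
        rw [hconcl]
        refine F.valid_of_instance hR σ ?_ ?_
        · intro m n hmn m' hm' n' hn'
          have hne : m' ≠ n' := by
            rintro rfl
            exact Set.disjoint_left.1 (hleg m n hmn) hm' hn'
          have hmem := (hact ⟨m', n', m, n, rfl, hne, hmn, hm', hn'⟩).1
          refine ⟨hne, ?_⟩
          rintro rfl
          rcases hmem with h | ⟨a, b, hab, -, ha, -⟩
          · exact hdv h
          · exact ha.2 (hoc a (hab ▸ Sym2.mem_mk_left a b))
        · intro B hB
          obtain ⟨j, hj, hjB⟩ := hlines _ ⟨B, hB, rfl⟩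
          exact ih j hj _ hjB
  rw [List.getLast?_eq_getElem?] at hlast
  exact key _ _ hlast

end Frame

/-! ### The two countermodels -/

/-- A frame with a single individual, in which `∀ x₀` forces `φ₀` to be true. -/
def forcingFrame : Frame s(.vr 0, .fm 0) where
  World := Prop
  Dom := Unit
  val _ _ := ()
  fm w j := j = 0 → w
  -- The world `False` does not see itself through ∀x₀; every other quantifier is the identity.
  rel i w v := if i = 0 then v = True else v = w
  inv i w v := i = 0 ∨ v = w
  inv_of_rel {i w v} h := by grind
  inv_symm {i w v} h := by grind
  inv_val _ _ := rfl
  inv_fm {i j w v} h hs := by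
    by_cases hj : j = 0
    · subst hj
      obtain rfl | rfl := h
      · exact absurd rfl hs.2
      · rfl
    · exact iff_of_true (fun h => absurd h hj) (fun h => absurd h hj)
  inv_forth {i j w v u} h _ hu := by
    by_cases hj : j = 0
    · exact ⟨True, by grind⟩
    · exact ⟨v, by grind⟩
  euclidean {i w u v} h h' := by grind
  comm {i j w u v} h h' := by
    by_cases hi : i = 0
    · exact ⟨True, by grind⟩
    · exact ⟨w, by grind⟩
  denot {i j} w _ := ⟨if j = 0 then True else w, by grind⟩
  subst {i j w u v} _ h h' _ _ := by grind
  genEq _ h _ _ _ _ := absurd rfl h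

theorem Separated.not_both_lt_two {i j : ℕ} (h : Separated s(.vr 0, .vr 1) (.vr i) (.vr j)) :
    i ≠ j ∧ ¬ (i < 2 ∧ j < 2) := by
  obtain ⟨h, h'⟩ := h
  refine ⟨fun e => h (e ▸ rfl), ?_⟩
  rintro ⟨hi, hj⟩
  interval_cases i <;> interval_cases j
  · exact h rfl
  · exact h' rfl
  · exact h' Sym2.eq_swap
  · exact h rfl

/-- A frame on two individuals, in which both `∀ x₀` and `∀ x₁` range over the simultaneous
assignments of one and the same individual to `x₀` and `x₁`. -/
def gluingFrame : Frame s(.vr 0, .vr 1) where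
  World := ℕ → Bool
  Dom := Bool
  val w := w
  fm _ _ := True
  rel i w v := if i < 2 then v 0 = v 1 ∧ ∀ k, 2 ≤ k → v k = w k else ∀ k, k ≠ i → v k = w k
  inv i w v := if i < 2 then ∀ k, 2 ≤ k → v k = w k else ∀ k, k ≠ i → v k = w k
  inv_of_rel {i w v} h := by grind
  inv_symm {i w v} h := by grind
  inv_val {i j w v} h hs := by
    have := hs.not_both_lt_two
    grind
  inv_fm _ _ := Iff.rfl
  inv_forth {i j w v u} h hs hu := by
    have := hs.not_both_lt_two
    -- The coordinates that ∀xⱼ can move (both 0 and 1 when j < 2) are copied from `u`, the others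
    -- from `v`. The witnesses for `comm` and `denot` follow the same pattern.
    refine ⟨fun k => if (j < 2 ∧ k < 2) ∨ k = j then u k else v k, ?_, ?_⟩ <;> grind
  euclidean {i w u v} h h' := by grind
  comm {i j w u v} h h' := by
    refine ⟨fun k => if (i < 2 ∧ k < 2) ∨ k = i then v k else w k, ?_, ?_⟩ <;> grind
  denot {i j} w hs := by
    have := hs.not_both_lt_two
    refine ⟨fun k => if (j < 2 ∧ k < 2) ∨ k = j then w i else w k, ?_, ?_⟩ <;> grind
  subst {i j w u v} hs h h' he he' := by
    have := hs.not_both_lt_two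
    funext k
    rcases Nat.lt_or_ge k 2 with hk | hk
    · interval_cases k <;> rcases Nat.lt_or_ge i 2 with hi | hi
      · interval_cases i <;> grind
      · grind
      · interval_cases i <;> grind
      · grind
    · grind
  genEq {i j k w u u' v} hu hne hu' hne' he hv := by
    rcases Nat.lt_or_ge i 2 with hi | hi
    -- For i, j < 2 every successor identifies xᵢ and xⱼ, contradicting the premise that one
    -- distinguishes them; likewise for k. So xⱼ and xₖ are not moved.
    · have hj : 2 ≤ j := by
        by_contra hj
        have : j < 2 := by omega
        interval_cases i <;> interval_cases j <;> grind
      have hk : 2 ≤ k := by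
        by_contra hk
        have : k < 2 := by omega
        interval_cases i <;> interval_cases k <;> grind
      grind
    · have hj : j ≠ i := by grind
      have hk : k ≠ i := by grind
      grind

/-! ### Independence results -/

variable (L)

theorem independent_schSpec :
    Independent (sysTMM L \ {schSpec L, schALLeq L}) (schSpec L) := by
  intro h
  have := forcingFrame.valid_of_provable (Φ := schSpec L) rfl (fun h => h.1)
    (by simp [Scheme.OC, occurring, schSpec, simpleScheme, Scheme.ofDV, MetaFormula.OC]) h False
  exact this (fun v hv _ => hv.symm ▸ trivial) rfl

theorem independent_schALLeq :
    Independent (sysTMM L \ {schSpec L, schALLeq L}) (schALLeq L) := by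
  intro h
  have := forcingFrame.valid_of_provable (Φ := schALLeq L) rfl (fun h => h.1)
    (by simp [Scheme.OC, occurring, schALLeq, simpleScheme, Scheme.ofDV, MetaFormula.OC]) h False
  -- ∀x₁ only sees the current world `False`, where φ₀ fails.
  exact this (fun _ _ => rfl) (fun v hv _ => hv.symm ▸ trivial) False rfl rfl

theorem independent_schSpecEq :
    Independent (sysTMM L \ {schSpec L, schALLeq L}) (schSpecEq L) := by
  intro h
  have := gluingFrame.valid_of_provable (Φ := schSpecEq L) rfl (fun h => h.1)
    (by simp [Scheme.OC, occurring, schSpecEq, simpleScheme, Scheme.ofDV, MetaFormula.OC]) h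
    -- An assignment that separates x₀ from x₁.
    (fun k => decide (k = 0))
  exact Bool.noConfusion (show true = false from this fun v hv => hv.1)

theorem isInstance_schSpecEq : IsInstance (schSpecEq L) (schSpec L) := by
  refine ⟨⟨id, fun i => if i = 0 then .eq 0 1 else .fm i, by simp, ?_⟩, ?_, ?_, rfl, ?_⟩
  · refine (Set.finite_singleton 0).subset fun i hi => ?_
    by_contra h
    exact hi (if_neg h)
  · exact fun m n h => h.1.elim
  · exact (Set.image_empty _).symm
  · rintro _ ⟨m, n, m', n', -, -, h, -⟩
    exact h.1.elim

variable {L}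

/-! ### Object-level proofs -/

/-- A sequence of formulas in which each one follows from earlier ones by an object-instance of a
scheme of `S`. -/
def ObjDerivation (S : Set (Scheme L)) (P : List (Formula L)) : Prop :=
  ∀ (k : ℕ) (A : Formula L), P[k]? = some A → ∃ I : Set (Formula L),
    (∀ B ∈ I, ∃ j < k, P[j]? = some B) ∧ ∃ R ∈ S, IsObjInstance ⟨I, A⟩ R

namespace ObjDerivation

variable {S : Set (Scheme L)} {P Q : List (Formula L)}

theorem append (hP : ObjDerivation S P) (hQ : ObjDerivation S Q) : ObjDerivation S (P ++ Q) := by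
  intro k A hA
  rcases lt_or_ge k P.length with hk | hk
  · rw [List.getElem?_append_left hk] at hA
    obtain ⟨I, hI, hR⟩ := hP k A hA
    refine ⟨I, fun B hB => ?_, hR⟩
    obtain ⟨j, hj, hjB⟩ := hI B hB
    exact ⟨j, hj, by rw [List.getElem?_append_left (hj.trans hk), hjB]⟩
  · rw [List.getElem?_append_right hk] at hA
    obtain ⟨I, hI, hR⟩ := hQ _ A hA
    refine ⟨I, fun B hB => ?_, hR⟩
    obtain ⟨j, hj, hjB⟩ := hI B hB
    refine ⟨P.length + j, by omega, ?_⟩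
    rw [List.getElem?_append_right (by omega), Nat.add_sub_cancel_left, hjB]

theorem concat (hP : ObjDerivation S P) {R : Scheme L} (hR : R ∈ S) {τ : ObjSubstitution L}
    (hτ : τ.Legitimate R) (h : ∀ A ∈ R.hyps, τ.act A ∈ P) :
    ObjDerivation S (P ++ [τ.act R.concl]) := by
  intro k A hA
  rcases lt_or_ge k P.length with hk | hk
  · rw [List.getElem?_append_left hk] at hA
    obtain ⟨I, hI, hR⟩ := hP k A hA
    refine ⟨I, fun B hB => ?_, hR⟩
    obtain ⟨j, hj, hjB⟩ := hI B hB
    exact ⟨j, hj, by rw [List.getElem?_append_left (hj.trans hk), hjB]⟩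
  · rw [List.getElem?_append_right hk] at hA
    have hA' : τ.act R.concl = A := List.mem_singleton.1 (List.mem_of_getElem? hA) |>.symm
    subst hA'
    refine ⟨τ.act '' R.hyps, ?_, R, hR, τ, hτ, rfl, rfl⟩
    rintro _ ⟨B, hB, rfl⟩
    obtain ⟨j, hj, hjB⟩ := List.getElem_of_mem (h B hB)
    exact ⟨j, hj.trans_le hk,
      by rw [List.getElem?_append_left hj, List.getElem?_eq_getElem hj, hjB]⟩

end ObjDerivation

/-- The object-level theorems of a set of schemes. -/
def ObjTheorem (S : Set (Scheme L)) (A : Formula L) : Prop :=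
  ∃ P, ObjDerivation S P ∧ P.getLast? = some A

namespace ObjTheorem

open Formula

variable {S : Set (Scheme L)}

theorem of_simpleScheme {c : MetaFormula L} {D : Set (Sym2 MetaVar)} (hS : simpleScheme c D ∈ S)
    (τ : ObjSubstitution L) (hτ : ∀ m n, s(m, n) ∈ D → Disjoint (τ.OC m) (τ.OC n)) :
    ObjTheorem S (τ.act c) :=
  ⟨_, ObjDerivation.concat (P := []) (fun k A h => by simp at h) hS (fun m n h => hτ m n h.1)
    (fun _ h => h.elim), by simp [simpleScheme, Scheme.ofDV]⟩

/-- The object-substitution with the given lists of values. -/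
def substOfList (l : List ℕ) (m : List (Formula L)) : ObjSubstitution L where
  vr i := l.getD i 0
  fm i := m.getD i (.eq 0 0)

variable {A B C D E : Formula L}

theorem mp (h : ObjTheorem (sysT L) (imp A B)) (h' : ObjTheorem (sysT L) A) :
    ObjTheorem (sysT L) B := by
  obtain ⟨P, hP, hPA⟩ := h
  obtain ⟨Q, hQ, hQA⟩ := h'
  refine ⟨_, (hP.append hQ).concat (R := schMp L) (τ := substOfList [] [A, B])
    (by simp [sysT, propcalc]) (fun m n h => h.1.elim) ?_, List.getLast?_concat⟩
  rintro _ (rfl | rfl)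
  · exact List.mem_append_right _ (List.mem_of_getLast? hQA)
  · exact List.mem_append_left _ (List.mem_of_getLast? hPA)

theorem gen (i : ℕ) (h : ObjTheorem (sysT L) A) : ObjTheorem (sysT L) (all i A) := by
  obtain ⟨P, hP, hPA⟩ := h
  refine ⟨_, hP.concat (R := schGen L) (τ := substOfList [i] [A])
    (by simp [sysT]) (fun m n h => h.1.elim) ?_, List.getLast?_concat⟩
  rintro _ rfl
  exact List.mem_of_getLast? hPA

theorem minimp : ObjTheorem (sysT L)
    (imp A (imp (imp B C) (imp (imp (imp D B) (imp C E)) (imp B E)))) :=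
  of_simpleScheme (show schMinimp L ∈ sysT L by simp [sysT, propcalc])
    (substOfList [] [A, B, C, D, E]) (fun _ _ h => h.elim)

theorem peirce : ObjTheorem (sysT L) (imp (imp (imp A B) A) A) :=
  of_simpleScheme (show schPeirce L ∈ sysT L by simp [sysT, propcalc])
    (substOfList [] [A, B]) (fun _ _ h => h.elim)

theorem contrap : ObjTheorem (sysT L) (imp (imp A (neg B)) (imp B (neg A))) :=
  of_simpleScheme (show schContrap L ∈ sysT L by simp [sysT, propcalc])
    (substOfList [] [A, B]) (fun _ _ h => h.elim)

theorem notelim : ObjTheorem (sysT L) (imp (neg A) (imp A B)) :=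
  of_simpleScheme (show schNotelim L ∈ sysT L by simp [sysT, propcalc])
    (substOfList [] [A, B]) (fun _ _ h => h.elim)

theorem all_imp (i : ℕ) :
    ObjTheorem (sysT L) (imp (all i (imp A B)) (imp (all i A) (all i B))) :=
  of_simpleScheme (show schALLdistr L ∈ sysT L by simp [sysT])
    (substOfList [i] [A, B]) (fun _ _ h => h.elim)

theorem eq_refl (i : ℕ) : ObjTheorem (sysT L) (eq i i) :=
  of_simpleScheme (show schEQrefl L ∈ sysT L by simp [sysT, EQ])
    (substOfList [i] []) (fun _ _ h => h.elim)

theorem eq_symm (i j : ℕ) : ObjTheorem (sysT L) (imp (eq i j) (eq j i)) :=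
  of_simpleScheme (show schEQsymm L ∈ sysT L by simp [sysT, EQ])
    (substOfList [i, j] []) (fun _ _ h => h.elim)

theorem eq_trans (i j k : ℕ) :
    ObjTheorem (sysT L) (imp (eq i j) (imp (eq j k) (eq i k))) :=
  of_simpleScheme (show schEQtrans L ∈ sysT L by simp [sysT, EQ])
    (substOfList [i, j, k] []) (fun _ _ h => h.elim)

theorem disjoint_OC_of_singleton {τ : ObjSubstitution L} {a b : MetaVar}
    (h : Disjoint (τ.OC a) (τ.OC b)) (m n : MetaVar)
    (hmn : s(m, n) ∈ ({s(a, b)} : Set (Sym2 MetaVar))) : Disjoint (τ.OC m) (τ.OC n) := by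
  rcases Sym2.eq_iff.1 (Set.mem_singleton_iff.1 hmn) with ⟨rfl, rfl⟩ | ⟨rfl, rfl⟩
  exacts [h, h.symm]

theorem vacGen {i : ℕ} (hi : i ∉ A.OC) : ObjTheorem (sysT L) (imp A (all i A)) :=
  of_simpleScheme (show schVacGen L ∈ sysT L by simp [sysT]) (substOfList [i] [A])
    (disjoint_OC_of_singleton (Set.disjoint_singleton_left.2 hi))

theorem denot {i j : ℕ} (h : i ≠ j) : ObjTheorem (sysT L) (neg (all j (neg (eq j i)))) :=
  (of_simpleScheme (show schDenot L ∈ sysT L by simp [sysT]) (substOfList [i, j] [])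
    (disjoint_OC_of_singleton (Set.disjoint_singleton_left.2 h))).mp (eq_refl i)

/-- Condensed detachment from the single axiom `minimp`; unification recovers the formulas. The same
holds for `imp_mp`, the S combinator with its first two premises exchanged. -/
theorem imp_intro : ObjTheorem (sysT L) (imp A (imp B A)) := by
  apply mp (mp (mp minimp minimp) minimp) (mp (mp (mp (mp minimp minimp) minimp)
    (mp minimp minimp)) (mp (mp (mp (mp minimp minimp) minimp) (mp minimp minimp))
    (mp (mp (mp minimp minimp) minimp) (mp minimp minimp))))
  -- Formulas left undetermined by unification are arbitrary, so any formula in context will do.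
  all_goals assumption

theorem imp_mp : ObjTheorem (sysT L) (imp (imp A B) (imp (imp A (imp B C)) (imp A C))) := by
  have p {A B : Formula L} := mp (A := A) (B := B)
  have m {A B C D E : Formula L} := minimp (A := A) (B := B) (C := C) (D := D) (E := E)
  apply (p (p (p (p (p m m) (p m m)) (p (p (p (p (p m m) m) (p (p (p m m) m) (p (p (p (p m m) m)
    (p m m)) m))) (p (p (p m m) m) (p m m))) (p (p (p (p m m) m) (p m m)) (p (p (p m m) m)
    (p (p m m) m))))) (p (p (p (p m m) m) (p m m)) m)) (p (p m m) (p (p (p m m) (p (p (p m m) m)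
    (p (p (p (p m m) m) (p m m)) (p (p (p (p m m) m) (p m m)) (p (p (p m m) m) (p m m))))))
    (p (p (p m m) (p (p (p (p m m) m) (p m m)) (p (p (p m m) m) (p (p m m) m)))) m))))
  all_goals assumption

end ObjTheorem

/-- Derivability by `mp` from a set of formulas and the object-level theorems of `T`. -/
inductive Entails (Γ : Set (Formula L)) : Formula L → Prop
  | hyp {A : Formula L} : A ∈ Γ → Entails Γ A
  | thm {A : Formula L} : ObjTheorem (sysT L) A → Entails Γ A
  | mp {A B : Formula L} : Entails Γ (.imp A B) → Entails Γ A → Entails Γ B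

namespace Entails

open Formula

variable {Γ : Set (Formula L)} {A B : Formula L}

theorem objTheorem (h : Entails ∅ A) : ObjTheorem (sysT L) A := by
  induction h with
  | hyp h => exact h.elim
  | thm h => exact h
  | mp _ _ ih ih' => exact ih.mp ih'

/-- Deduction theorem. It needs no side condition because generalization applies only to theorems,
never under hypotheses. -/
theorem intro (h : Entails (insert A Γ) B) : Entails Γ (imp A B) := by
  induction h with
  | @hyp C h =>
    rcases h with h | h
    · subst h
      exact mp (mp (thm ObjTheorem.imp_mp) (thm (ObjTheorem.imp_intro (B := C))))
        (thm ObjTheorem.imp_intro)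
    · exact mp (thm ObjTheorem.imp_intro) (hyp h)
  | thm h => exact thm (ObjTheorem.imp_intro.mp h)
  | mp _ _ ih ih' => exact mp (mp (thm ObjTheorem.imp_mp) ih') ih

theorem by_contra (h : Entails (insert (neg A) Γ) B) (h' : Entails (insert (neg A) Γ) (neg B)) :
    Entails Γ A := by
  have hA : Entails Γ (imp (neg A) A) := intro (mp (mp (thm ObjTheorem.notelim) h') h)
  -- The formula ¬ v₀≡v₀ plays the role of falsum in Peirce's law.
  have hn : Entails Γ (imp (imp A (neg (eq 0 0))) (neg A)) :=
    intro (mp (mp (thm ObjTheorem.contrap) (hyp (Or.inl rfl))) (thm (ObjTheorem.eq_refl 0)))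
  exact mp (thm ObjTheorem.peirce) (mp (mp (thm ObjTheorem.imp_mp) hn)
    (mp (thm ObjTheorem.imp_intro) hA))

end Entails

namespace ObjTheorem

open Formula

/-- If w≢y, then ∀x w≢y by `vacGen`, as x differs from w and y. Together with ∀x x≡y this gives ∀x
x≢w, which contradicts `denot`. -/
theorem imp_eq_of_all_eq {x y w : ℕ} (hxy : x ≠ y) (hw : x ≠ w) :
    ObjTheorem (sysT L) (imp (all x (eq x y)) (eq w y)) := by
  have key : ObjTheorem (sysT L) (imp (eq x y) (imp (neg (eq w y)) (neg (eq x w)))) := by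
    refine Entails.objTheorem (.intro (.intro (.mp (.mp (.thm (contrap (A := eq x w)))
      (.intro ?_)) (.thm (eq_refl 0)))))
    refine .mp (.mp (.thm notelim) (.hyp (Or.inr (Or.inl rfl)))) ?_
    exact .mp (.mp (.thm (eq_trans w x y)) (.mp (.thm (eq_symm x w)) (.hyp (Or.inl rfl))))
      (.hyp (Or.inr (Or.inr (Or.inl rfl))))
  refine Entails.objTheorem (.intro (.by_contra (B := all x (neg (eq x w))) ?_
    (.thm (denot hw.symm))))
  refine .mp (.mp (.thm (all_imp x)) (.mp (.mp (.thm (all_imp x)) (.thm (gen x key))) ?_))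
    (.mp (.thm (vacGen ?_)) ?_)
  · exact .hyp (Or.inr (Or.inl rfl))
  · rintro (h | h)
    exacts [hw h, hxy h]
  · exact .hyp (Or.inl rfl)

/-- The previous lemma excludes w = x, so it is used twice through a fresh w: ∀x x≡y gives ∀w ∀x x≡y
by `vacGen`, hence ∀w w≡y, hence x≡y with w now as the bound variable. -/
theorem spec_eq (x y : ℕ) : ObjTheorem (sysT L) (imp (all x (eq x y)) (eq x y)) := by
  rcases eq_or_ne x y with rfl | hxy
  · exact imp_intro.mp (eq_refl x)
  obtain ⟨w, hw⟩ := Infinite.exists_notMem_finset ({x, y} : Finset ℕ)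
  simp only [Finset.mem_insert, Finset.mem_singleton, not_or] at hw
  refine Entails.objTheorem (.intro (.mp (.thm (imp_eq_of_all_eq (w := x) hw.2 hw.1))
    (.mp (.mp (.thm (all_imp w)) (.thm (gen w (imp_eq_of_all_eq hxy (Ne.symm hw.1)))))
      (.mp (.thm (vacGen ?_)) (.hyp (Or.inl rfl))))))
  rintro (h | h | h)
  exacts [hw.1 h, hw.1 h, hw.2 h]

end ObjTheorem

theorem objectProvable_schSpecEq : ObjectProvable (sysT L) (schSpecEq L) := by
  rintro ⟨H, c⟩ ⟨τ, -, -, rfl⟩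
  obtain ⟨P, hP, hlast⟩ := ObjTheorem.spec_eq (L := L) (τ.vr 0) (τ.vr 1)
  exact ⟨P, fun k A hA => Or.inr (hP k A hA), hlast⟩

end TMMLogic

theorem mainTheorem2 (L : TMMLogic.PredLanguage) :
    TMMLogic.Independent (TMMLogic.sysTMM L \ {TMMLogic.schSpec L, TMMLogic.schALLeq L})
      (TMMLogic.schSpec L) ∧
    TMMLogic.Independent (TMMLogic.sysTMM L \ {TMMLogic.schSpec L, TMMLogic.schALLeq L})
      (TMMLogic.schALLeq L) ∧
    (TMMLogic.IsInstance (TMMLogic.schSpecEq L) (TMMLogic.schSpec L) ∧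
      (∀ i : ℕ, TMMLogic.MetaVar.fm i ∉ (TMMLogic.schSpecEq L).OC) ∧
      TMMLogic.Independent (TMMLogic.sysTMM L \ {TMMLogic.schSpec L, TMMLogic.schALLeq L})
        (TMMLogic.schSpecEq L) ∧
      TMMLogic.ObjectProvable (TMMLogic.sysT L) (TMMLogic.schSpecEq L)) := by
  refine ⟨TMMLogic.independent_schSpec L, TMMLogic.independent_schALLeq L,
    TMMLogic.isInstance_schSpecEq L, fun i => ?_, TMMLogic.independent_schSpecEq L,
    TMMLogic.objectProvable_schSpecEq⟩
  simp [TMMLogic.Scheme.OC, TMMLogic.occurring, TMMLogic.schSpecEq, TMMLogic.simpleScheme,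
    TMMLogic.Scheme.ofDV, TMMLogic.MetaFormula.OC]
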